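/- Let $D$ be an integral domain with quotient field $K$ and let $X$ be an indeterminate. For a domain $R$ with quotient field $L$, let $\overline{\boldsymbol F}(R)$ be the set of all nonzero $R$-submodules of $L$. A semistar operation of $R$ is a map $\star:\overline{\boldsymbol F}(R)\to\overline{\boldsymbol F}(R)$, $E\mapsto E^\star$, such that $(xE)^\star=xE^\star$, $E\subseteq F\Rightarrow E^\star\subseteq F^\star$, $E\subseteq E^\star$ and $(E^\star)^\star=E^\star$ for all $0\ne x\in L$ and $E,F\in\overline{\boldsymbol F}(R)$. The associated operation of finite type $\star_f$ sends $E$ to the union of all $F^\star$, where $F$ runs through the nonzero finitely generated $R$-submodules of $E$. Let $\operatorname{QMax}^{\star}(R)$ be the set of those (necessarily prime) ideals that are maximal among the proper nonzero ideals $I$ of $R$ with $I^\star\cap R=I$. The stable semistar operation of finite type $\widetilde{\star}$ associated to $\star$ is given by $$E^{\widetilde{\star}}=\bigcap\{ER_P\mid P\in\operatorname{QMax}^{\star_f}(R)\}.$$ (Here and below, the intersection of the empty family of submodules of $L$ is $L$.) Let $\star$ be a semistar operation of $D$. For $E\in\overline{\boldsymbol F}(D)$, let $E[X]$ be the set of all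 polynomials with coefficients in $E$; for a $D[X]$-submodule $B$ of $K[X]$, let $\boldsymbol c_D(B)$ be the $D$-submodule of $K$ generated by the coefficients of all $f\in B$. For $A\in\overline{\boldsymbol F}(D[X])$, put $(K[X]:A)=\{z\in K(X)\mid zA\subseteq K[X]\}$ and let $$A^{\blacktriangle^{\star}}=\bigcap\{z^{-1}\,(\boldsymbol c_D(zA))^\star[X]\mid 0\neq z\in(K[X]:A)\}\ \text{ if }(K[X]:A)\neq(0),\qquad A^{\blacktriangle^{\star}}=K(X)\ \text{ if }(K[X]:A)=(0).$$ Then $\blacktriangle^{\star}$ is a semistar operation of $D[X]$. For a prime ideal $Q$ of $D$, let $D_Q(X)=\{f/g\mid f,g\in D_Q[X],\ \text{the coefficients of } g \text{ generate the unit ideal of } D_Q\}$ be the Nagata ring of $D_Q$, and let $\langle\widetilde{\star}\rangle$ be the semistar operation of $D[X]$ defined by $$A^{\langle\widetilde{\star}\rangle}=\bigcap\{AD_Q(X)\mid Q\in\operatorname{QMax}^{\star_f}(D)\}\cap AK[X]\qquad(A\in\overline{\boldsymbol F}(D[X])).$$ **Theorem.** For every semistar operation $\star$ of $D$, $\widetilde{\blacktriangle^{\star}}=\langle\widetilde{\star}\rangle$;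 that is, $$A^{\widetilde{\blacktriangle^{\star}}}=\bigcap\{AD_Q(X)\mid Q\in\operatorname{QMax}^{\star_f}(D)\}\cap AK[X]\quad\text{for each }A\in\overline{\boldsymbol F}(D[X]).$$ -/

import Mathlib

open Polynomial
open scoped Pointwise

/- For an `R`-algebra `A`, the ring `A[X]` is an `R[X]`-algebra through the map on coefficients. -/
attribute [local instance] Polynomial.algebra

set_option linter.unusedSectionVars false

noncomputable section SemistarTheory

/-! ### Nonzero submodules and semistar operations -/

/-- The set of all nonzero `R`-submodules of `K`. -/
abbrev NonzeroSubmodule (R K : Type*) [CommRing R] [Field K] [Algebra R K] :=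
  {E : Submodule R K // E ≠ ⊥}

section General

variable {R K : Type*} [CommRing R] [Field K] [Algebra R K]

theorem le_smul_iff_inv_smul_le {x : K} (hx : x ≠ 0) {E F : Submodule R K} :
    E ≤ x • F ↔ x⁻¹ • E ≤ F := by
  constructor
  · intro h y hy
    rw [Submodule.mem_smul_iff_inv_mul_mem (inv_ne_zero hx), inv_inv] at hy
    have := h hy
    rwa [Submodule.mem_smul_iff_inv_mul_mem hx, inv_mul_cancel_left₀ hx] at this
  · intro h y hy
    rw [Submodule.mem_smul_iff_inv_mul_mem hx]
    apply h
    rw [Submodule.mem_smul_iff_inv_mul_mem (inv_ne_zero hx), inv_inv, mul_inv_cancel_left₀ hx]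
    exact hy

theorem inv_smul_smul_submodule {x : K} (hx : x ≠ 0) (E : Submodule R K) : x⁻¹ • x • E = E := by
  rw [smul_smul, inv_mul_cancel₀ hx, one_smul]

theorem smul_inv_smul_submodule {x : K} (hx : x ≠ 0) (E : Submodule R K) : x • x⁻¹ • E = E := by
  rw [smul_smul, mul_inv_cancel₀ hx, one_smul]

theorem smul_submodule_mono (x : K) {E F : Submodule R K} (h : E ≤ F) : x • E ≤ x • F :=
  Submodule.map_mono h

theorem smul_submodule_ne_bot {x : K} (hx : x ≠ 0) {E : Submodule R K} (hE : E ≠ ⊥) :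
    x • E ≠ ⊥ := by
  intro h
  apply hE
  rw [← inv_smul_smul_submodule hx E, h, Submodule.smul_bot']

theorem ne_bot_of_submodule_le {E F : Submodule R K} (hE : E ≠ ⊥) (h : E ≤ F) : F ≠ ⊥ :=
  fun hF => hE (le_bot_iff.mp (hF ▸ h))

/-- The submodule `xE`, for `0 ≠ x ∈ K` and a nonzero submodule `E`. -/
def NonzeroSubmodule.scale (x : K) (hx : x ≠ 0) (E : NonzeroSubmodule R K) :
    NonzeroSubmodule R K :=
  ⟨x • E.1, smul_submodule_ne_bot hx E.2⟩

end General

/-- A semistar operation of `R`, where `K` is the quotient field of `R`. -/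
@[ext]
structure SemistarOperation (R K : Type*) [CommRing R] [Field K] [Algebra R K] where
  /-- The map `E ↦ E^⋆`. -/
  toFun : NonzeroSubmodule R K → NonzeroSubmodule R K
  scale' : ∀ (x : K) (hx : x ≠ 0) (E : NonzeroSubmodule R K),
    toFun (E.scale x hx) = (toFun E).scale x hx
  mono' : ∀ E F : NonzeroSubmodule R K, E ≤ F → toFun E ≤ toFun F
  le' : ∀ E : NonzeroSubmodule R K, E ≤ toFun E
  idem' : ∀ E : NonzeroSubmodule R K, toFun (toFun E) = toFun E

namespace SemistarOperation

section General

variable {R K : Type*} [CommRing R] [Field K] [Algebra R K]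

instance : CoeFun (SemistarOperation R K)
    (fun _ => NonzeroSubmodule R K → NonzeroSubmodule R K) := ⟨SemistarOperation.toFun⟩

/-- A semistar operation from a map with values in all submodules, with the equalities weakened to
the inclusions that imply them. -/
def ofLE (f : NonzeroSubmodule R K → Submodule R K)
    (le : ∀ E, E.1 ≤ f E) (mono : ∀ E F : NonzeroSubmodule R K, E ≤ F → f E ≤ f F)
    (scale_le : ∀ (x : K) (hx : x ≠ 0) (E : NonzeroSubmodule R K), f (E.scale x hx) ≤ x • f E)
    (idem_le : ∀ E, f ⟨f E, ne_bot_of_submodule_le E.2 (le E)⟩ ≤ f E) :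
    SemistarOperation R K where
  toFun E := ⟨f E, ne_bot_of_submodule_le E.2 (le E)⟩
  scale' x hx E := by
    apply Subtype.ext
    apply le_antisymm (scale_le x hx E)
    have h := scale_le x⁻¹ (inv_ne_zero hx) (E.scale x hx)
    have h2 : (E.scale x hx).scale x⁻¹ (inv_ne_zero hx) = E :=
      Subtype.ext (inv_smul_smul_submodule hx E.1)
    rw [h2, le_smul_iff_inv_smul_le (inv_ne_zero hx), inv_inv] at h
    exact h
  mono' := mono
  le' := le
  idem' E := Subtype.ext (le_antisymm (idem_le E) (le _))

/-! ### The operation of finite type associated to a semistar operation -/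

/-- The union of all `F^⋆`, for `F` a nonzero finitely generated submodule of `E`.  The family is
directed, so that its supremum is its union. -/
def finiteTypeFun (s : SemistarOperation R K) (E : NonzeroSubmodule R K) : Submodule R K :=
  ⨆ (F : NonzeroSubmodule R K) (_ : F.1.FG ∧ F ≤ E), (s F).1

theorem exists_fg_le (E : NonzeroSubmodule R K) :
    ∃ F : NonzeroSubmodule R K, F.1.FG ∧ F ≤ E := by
  obtain ⟨x, hx, hx0⟩ := Submodule.exists_mem_ne_zero_of_ne_bot E.2
  refine ⟨⟨Submodule.span R {x}, ?_⟩, Submodule.fg_span_singleton x, ?_⟩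
  · simpa [Submodule.span_singleton_eq_bot] using hx0
  · exact (Submodule.span_singleton_le_iff_mem _ _).mpr hx

theorem mem_finiteTypeFun (s : SemistarOperation R K) (E : NonzeroSubmodule R K) (x : K) :
    x ∈ s.finiteTypeFun E ↔ ∃ F : NonzeroSubmodule R K, (F.1.FG ∧ F ≤ E) ∧ x ∈ (s F).1 := by
  have : Nonempty {F : NonzeroSubmodule R K // F.1.FG ∧ F ≤ E} :=
    let ⟨F, hF⟩ := exists_fg_le E; ⟨⟨F, hF⟩⟩
  have hd : Directed (· ≤ ·)
      (fun F : {F : NonzeroSubmodule R K // F.1.FG ∧ F ≤ E} => (s F.1).1) := by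
    rintro ⟨F, hF⟩ ⟨G, hG⟩
    refine ⟨⟨⟨F.1 ⊔ G.1, ne_bot_of_submodule_le F.2 le_sup_left⟩, hF.1.sup hG.1,
      sup_le (show F.1 ≤ E.1 from hF.2) hG.2⟩, ?_, ?_⟩
    · exact s.mono' _ _ (le_sup_left : F.1 ≤ F.1 ⊔ G.1)
    · exact s.mono' _ _ (le_sup_right : G.1 ≤ F.1 ⊔ G.1)
  rw [finiteTypeFun, iSup_subtype', Submodule.mem_iSup_of_directed _ hd]
  simp

theorem exists_fg_of_le_finiteTypeFun (s : SemistarOperation R K) (E : NonzeroSubmodule R K)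
    (G : Submodule R K) (hG : G.FG) (h : G ≤ s.finiteTypeFun E) :
    ∃ F : NonzeroSubmodule R K, (F.1.FG ∧ F ≤ E) ∧ G ≤ (s F).1 := by
  induction G, hG using Submodule.fg_induction with
  | singleton x =>
    obtain ⟨F, hF, hx⟩ := (s.mem_finiteTypeFun E x).mp (h (Submodule.mem_span_singleton_self x))
    exact ⟨F, hF, (Submodule.span_singleton_le_iff_mem _ _).mpr hx⟩
  | sup G₁ G₂ _ _ h₁ h₂ =>
    obtain ⟨F, hF, hx⟩ := h₁ (le_sup_left.trans h)
    obtain ⟨F', hF', hx'⟩ := h₂ (le_sup_right.trans h)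
    refine ⟨⟨F.1 ⊔ F'.1, ne_bot_of_submodule_le F.2 le_sup_left⟩,
      ⟨hF.1.sup hF'.1, sup_le (show F.1 ≤ E.1 from hF.2) hF'.2⟩, sup_le (hx.trans ?_)
        (hx'.trans ?_)⟩
    · exact s.mono' _ _ (le_sup_left : F.1 ≤ F.1 ⊔ F'.1)
    · exact s.mono' _ _ (le_sup_right : F'.1 ≤ F.1 ⊔ F'.1)

/-- `⋆_f`, the semistar operation of finite type associated to `⋆`. -/
def finiteType (s : SemistarOperation R K) : SemistarOperation R K :=
  ofLE s.finiteTypeFun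
    (fun E x hx => by
      rw [mem_finiteTypeFun]
      by_cases h0 : x = 0
      · obtain ⟨F, hF⟩ := exists_fg_le E
        exact ⟨F, hF, h0 ▸ zero_mem _⟩
      · have hb : Submodule.span R {x} ≠ ⊥ := by
          simpa [Submodule.span_singleton_eq_bot] using h0
        exact ⟨⟨Submodule.span R {x}, hb⟩, ⟨Submodule.fg_span_singleton x,
          (Submodule.span_singleton_le_iff_mem _ _).mpr hx⟩,
          s.le' ⟨_, hb⟩ (Submodule.mem_span_singleton_self x)⟩)
    (fun E F h x hx => by
      rw [mem_finiteTypeFun] at hx ⊢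
      obtain ⟨G, hG, hx⟩ := hx
      exact ⟨G, ⟨hG.1, hG.2.trans h⟩, hx⟩)
    (fun x hx E y hy => by
      rw [mem_finiteTypeFun] at hy
      obtain ⟨F, ⟨hF, hFE⟩, hy⟩ := hy
      rw [Submodule.mem_smul_iff_inv_mul_mem hx, mem_finiteTypeFun]
      refine ⟨F.scale x⁻¹ (inv_ne_zero hx), ⟨hF.map _, ?_⟩, ?_⟩
      · change x⁻¹ • F.1 ≤ E.1
        rw [← le_smul_iff_inv_smul_le hx]
        exact hFE
      · rw [s.scale']
        exact Submodule.smul_mem_pointwise_smul _ x⁻¹ _ hy)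
    (fun E x hx => by
      rw [mem_finiteTypeFun] at hx ⊢
      obtain ⟨G, ⟨hG, hGE⟩, hx⟩ := hx
      obtain ⟨F, hF, h⟩ := s.exists_fg_of_le_finiteTypeFun E G.1 hG hGE
      refine ⟨F, hF, ?_⟩
      have := s.mono' G (s F) h hx
      rwa [s.idem'] at this)

/-! ### Operations defined by families of overrings, spectral operations -/

/-- The semistar operation `E ↦ ⋂ {ET | T ∈ 𝒯}` defined by a set `𝒯` of overrings of `R` in `K`
(the intersection over the empty family is `K`). -/
def ofOverrings (𝒯 : Set (Subalgebra R K)) : SemistarOperation R K :=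
  ofLE (fun E => ⨅ T ∈ 𝒯, E.1 * Subalgebra.toSubmodule T)
    (fun E x hx => by
      simp only [Submodule.mem_iInf]
      intro T _
      simpa using Submodule.mul_mem_mul hx (show (1 : K) ∈ Subalgebra.toSubmodule T from T.one_mem))
    (fun E F h => iInf₂_mono fun T _ => mul_le_mul_left (show E.1 ≤ F.1 from h) _)
    (fun x hx E => by
      rw [le_smul_iff_inv_smul_le hx]
      refine le_iInf₂ fun T hT => ?_
      rw [← le_smul_iff_inv_smul_le hx, ← smul_mul_assoc]
      exact iInf₂_le T hT)
    (fun E => le_iInf₂ fun T hT => by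
      refine (iInf₂_le T hT).trans ?_
      refine (mul_le_mul_left (iInf₂_le T hT) _).trans ?_
      rw [mul_assoc, (Subalgebra.isIdempotentElem_toSubmodule T).eq])

end General

section Domain

variable {R K : Type*} [CommRing R] [IsDomain R] [Field K] [Algebra R K] [IsFractionRing R K]

/-- The localization `R_P`, as a subring of the quotient field. -/
def localizationAt (K : Type*) [Field K] [Algebra R K] [IsFractionRing R K]
    (P : PrimeSpectrum R) : Subalgebra R K :=
  Localization.subalgebra.ofField K P.asIdeal.primeCompl P.asIdeal.primeCompl_le_nonZeroDivisors

/-- The spectral semistar operation `E ↦ ⋂ {E R_P | P ∈ Δ}`. -/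
def spectral (Δ : Set (PrimeSpectrum R)) : SemistarOperation R K :=
  ofOverrings (localizationAt K '' Δ)

/-- A nonzero integral ideal, as a nonzero submodule of `K`. -/
def idealSubmodule (K : Type*) [Field K] [Algebra R K] [IsFractionRing R K]
    (I : Ideal R) (hI : I ≠ ⊥) : NonzeroSubmodule R K :=
  ⟨IsLocalization.coeSubmodule K I, fun h => hI (by
    rw [← IsLocalization.coeSubmodule_bot (R := R) K] at h
    exact IsFractionRing.coeSubmodule_injective R K h)⟩

/-- `I` is a quasi-`⋆`-ideal: a nonzero integral ideal with `I^⋆ ∩ R = I`. -/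
def IsQuasiIdeal (s : SemistarOperation R K) (I : Ideal R) : Prop :=
  ∃ hI : I ≠ ⊥, (s (idealSubmodule K I hI)).1.comap (Algebra.linearMap R K) = I

/-- `I` is maximal in the set of all proper quasi-`⋆`-ideals. -/
def IsQuasiMaximal (s : SemistarOperation R K) (I : Ideal R) : Prop :=
  Maximal (fun J : Ideal R => J ≠ ⊤ ∧ s.IsQuasiIdeal J) I

theorem mem_of_smul_mem_quasiIdeal {s : SemistarOperation R K} {M I : Ideal R}
    (hM : s.IsQuasiIdeal M) (hI : I ≠ ⊥) {b : R} (hb : b ≠ 0) (hIM : ∀ x ∈ I, b * x ∈ M) {y : R}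
    (hy : algebraMap R K y ∈ (s (idealSubmodule K I hI)).1) : b * y ∈ M := by
  obtain ⟨hM0, hM⟩ := hM
  have hb' : algebraMap R K b ≠ 0 := by
    simpa using hb
  rw [← hM, Submodule.mem_comap, Algebra.linearMap_apply, map_mul]
  have h1 : (idealSubmodule K I hI).scale _ hb' ≤ idealSubmodule K M hM0 := by
    intro z hz
    obtain ⟨w, hw, rfl⟩ := hz
    obtain ⟨x, hx, rfl⟩ := (IsLocalization.mem_coeSubmodule K I).mp hw
    exact (IsLocalization.mem_coeSubmodule K M).mpr ⟨b * x, hIM x hx, by simp⟩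
  have h2 := s.mono' _ _ h1
  rw [s.scale'] at h2
  exact h2 (Submodule.smul_mem_pointwise_smul _ _ _ hy)

theorem IsQuasiMaximal.isPrime {s : SemistarOperation R K} {M : Ideal R}
    (hM : s.IsQuasiMaximal M) : M.IsPrime := by
  obtain ⟨⟨htop, hq⟩, hmax⟩ := hM
  refine ⟨htop, fun {a b} hab => ?_⟩
  by_contra! hcon
  obtain ⟨ha, hb⟩ := hcon
  have hb0 : b ≠ 0 := fun h => hb (h ▸ zero_mem _)
  let I : Ideal R := Submodule.comap (LinearMap.mulLeft R b) M
  have hMI : M ≤ I := fun x hx => M.mul_mem_left b hx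
  have haI : a ∈ I := by
    change b * a ∈ M
    rwa [mul_comm]
  have hI0 : I ≠ ⊥ := fun h => hq.1 (le_bot_iff.mp (h ▸ hMI))
  have hI : s.IsQuasiIdeal I := by
    refine ⟨hI0, le_antisymm ?_ ?_⟩
    · intro y hy
      exact mem_of_smul_mem_quasiIdeal hq hI0 hb0 (fun x hx => hx) hy
    · intro y hy
      exact s.le' (idealSubmodule K I hI0)
        ((IsLocalization.mem_coeSubmodule K I).mpr ⟨y, hy, rfl⟩)
  by_cases h1 : I = ⊤
  · have h2 : (1 : R) ∈ I := h1 ▸ Submodule.mem_top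
    change b * 1 ∈ M at h2
    rw [mul_one] at h2
    exact hb h2
  · exact ha (hmax ⟨h1, hI⟩ hMI haI)

/-- The set of all quasi-`⋆`-maximal ideals; these are prime ideals by `IsQuasiMaximal.isPrime`. -/
def QMax (s : SemistarOperation R K) : Set (PrimeSpectrum R) :=
  {P | s.IsQuasiMaximal P.asIdeal}

/-- The stable semistar operation of finite type associated to `⋆`:
`E ↦ ⋂ {E R_P | P ∈ QMax^{⋆_f}(R)}`. -/
def stableFiniteType (s : SemistarOperation R K) : SemistarOperation R K :=
  spectral s.finiteType.QMax

end Domain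

end SemistarOperation

/-! ### Polynomials -/

section Poly

variable {D K : Type*} [CommRing D] [Field K] [Algebra D K]

/-- `E[X]`, the set of all polynomials with coefficients in `E`, as a submodule of `K(X)`. -/
def polySubmodule (E : Submodule D K) : Submodule D[X] (RatFunc K) where
  carrier := {φ | ∃ f : K[X], (∀ n, f.coeff n ∈ E) ∧ algebraMap K[X] (RatFunc K) f = φ}
  add_mem' := by
    rintro _ _ ⟨f, hf, rfl⟩ ⟨g, hg, rfl⟩
    exact ⟨f + g, fun n => by rw [coeff_add]; exact add_mem (hf n) (hg n), map_add _ _ _⟩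
  zero_mem' := ⟨0, fun n => by simp, map_zero _⟩
  smul_mem' := by
    rintro c _ ⟨f, hf, rfl⟩
    refine ⟨c • f, fun n => ?_, ?_⟩
    · rw [Algebra.smul_def, Polynomial.algebraMap_def, coe_mapRingHom, coeff_mul]
      refine sum_mem fun i _ => ?_
      rw [coeff_map, ← Algebra.smul_def]
      exact E.smul_mem _ (hf _)
    · rw [Algebra.smul_def, Algebra.smul_def, map_mul, ← IsScalarTower.algebraMap_apply]

/-- The content `co_D(A)`: the `D`-submodule of `K` generated by the coefficients of all
polynomials that belong to `A`.  It is used for submodules `A` of `K[X]`. -/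
def contentSubmodule (A : Submodule D[X] (RatFunc K)) : Submodule D K :=
  Submodule.span D {c | ∃ f : K[X], algebraMap K[X] (RatFunc K) f ∈ A ∧ ∃ n, f.coeff n = c}

theorem polySubmodule_mono {E F : Submodule D K} (h : E ≤ F) :
    polySubmodule E ≤ polySubmodule F := by
  rintro _ ⟨f, hf, rfl⟩
  exact ⟨f, fun n => h (hf n), rfl⟩

theorem contentSubmodule_mono {A B : Submodule D[X] (RatFunc K)} (h : A ≤ B) :
    contentSubmodule A ≤ contentSubmodule B :=
  Submodule.span_mono fun _ ⟨f, hf, hn⟩ => ⟨f, h hf, hn⟩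

theorem le_polySubmodule_contentSubmodule {A : Submodule D[X] (RatFunc K)}
    (hA : A ≤ polySubmodule ⊤) : A ≤ polySubmodule (contentSubmodule A) := by
  intro φ hφ
  obtain ⟨f, -, rfl⟩ := hA hφ
  exact ⟨f, fun n => Submodule.subset_span ⟨f, hφ, n, rfl⟩, rfl⟩

theorem contentSubmodule_polySubmodule_le (E : Submodule D K) :
    contentSubmodule (polySubmodule E) ≤ E := by
  refine Submodule.span_le.mpr ?_
  rintro _ ⟨f, ⟨g, hg, hgf⟩, n, rfl⟩
  rw [IsFractionRing.injective K[X] (RatFunc K) hgf] at hg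
  exact hg n

theorem contentSubmodule_ne_bot {A : Submodule D[X] (RatFunc K)} (h0 : A ≠ ⊥)
    (hA : A ≤ polySubmodule ⊤) : contentSubmodule A ≠ ⊥ := by
  intro h
  apply h0
  rw [eq_bot_iff]
  intro φ hφ
  obtain ⟨f, hf, rfl⟩ := le_polySubmodule_contentSubmodule hA hφ
  rw [h] at hf
  have : f = 0 := by ext n; simpa using hf n
  simp [this]

/-- `K[X]`, as an overring of `D[X]` in `K(X)`. -/
def polyOverring (D K : Type*) [CommRing D] [Field K] [Algebra D K] :
    Subalgebra D[X] (RatFunc K) :=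
  (IsScalarTower.toAlgHom D[X] K[X] (RatFunc K)).range

/-- The Nagata ring `T(X) = {f / g | f, g ∈ T[X], g has unit content}` of an overring `T` of `D`,
as an overring of `D[X]` in `K(X)`. -/
def nagataRing (T : Subalgebra D K) : Subalgebra D[X] (RatFunc K) where
  carrier := {φ | ∃ f g : T[X], g.contentIdeal = ⊤ ∧
    φ = algebraMap K[X] (RatFunc K) (f.map (algebraMap T K)) /
      algebraMap K[X] (RatFunc K) (g.map (algebraMap T K))}
  mul_mem' := by
    rintro _ _ ⟨f, g, hg, rfl⟩ ⟨f', g', hg', rfl⟩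
    refine ⟨f * f', g * g', contentIdeal_mul_eq_top_of_contentIdeal_eq_top hg hg', ?_⟩
    rw [Polynomial.map_mul, Polynomial.map_mul, map_mul, map_mul, div_mul_div_comm]
  add_mem' := by
    rintro _ _ ⟨f, g, hg, rfl⟩ ⟨f', g', hg', rfl⟩
    refine ⟨f * g' + g * f', g * g', contentIdeal_mul_eq_top_of_contentIdeal_eq_top hg hg', ?_⟩
    have key : ∀ g : T[X], g.contentIdeal = ⊤ →
        algebraMap K[X] (RatFunc K) (g.map (algebraMap T K)) ≠ 0 := by
      intro g hg h0
      rw [FaithfulSMul.algebraMap_eq_zero_iff, Polynomial.map_eq_zero_iff Subtype.val_injective]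
        at h0
      rw [h0, contentIdeal_zero] at hg
      exact bot_ne_top hg
    rw [div_add_div _ _ (key g hg) (key g' hg')]
    simp only [Polynomial.map_mul, Polynomial.map_add, map_mul, map_add]
  algebraMap_mem' p := by
    refine ⟨p.map (algebraMap D T), 1, contentIdeal_one, ?_⟩
    rw [Polynomial.map_map, ← IsScalarTower.algebraMap_eq, Polynomial.map_one, map_one, div_one,
      IsScalarTower.algebraMap_apply D[X] K[X] (RatFunc K), Polynomial.algebraMap_def,
      coe_mapRingHom]

/-- `z` is a nonzero element of `(K[X] : A)`. -/
def IsPolyMultiplier (A : Submodule D[X] (RatFunc K)) (z : RatFunc K) : Prop :=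
  z ≠ 0 ∧ z ∈ Subalgebra.toSubmodule (polyOverring D K) / A

theorem isPolyMultiplier_iff {A : Submodule D[X] (RatFunc K)} {z : RatFunc K} :
    IsPolyMultiplier A z ↔ z ≠ 0 ∧ z • A ≤ polySubmodule ⊤ := by
  refine and_congr_right fun _ => ?_
  rw [Submodule.mem_div_iff_forall_mul_mem]
  constructor
  · rintro h _ ⟨y, hy, rfl⟩
    obtain ⟨f, hf⟩ := h y hy
    exact ⟨f, fun n => Submodule.mem_top, hf⟩
  · intro h y hy
    obtain ⟨f, -, hf⟩ := h (Submodule.smul_mem_pointwise_smul y z A hy)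
    exact ⟨f, hf⟩

/-- The nonzero `D`-submodule `co_D(zA)` of `K`, for a nonzero `z` in `(K[X] : A)`. -/
def contentScaled (A : NonzeroSubmodule D[X] (RatFunc K)) (z : RatFunc K)
    (hz : IsPolyMultiplier A.1 z) : NonzeroSubmodule D K :=
  ⟨contentSubmodule (z • A.1), contentSubmodule_ne_bot (smul_submodule_ne_bot hz.1 A.2)
    (isPolyMultiplier_iff.mp hz).2⟩

namespace SemistarOperation

/-- `⋂ z⁻¹ (co_D(zA))^⋆[X]`, over all nonzero `z` in `(K[X] : A)`.  If `(K[X] : A) = (0)`, then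
the intersection is over the empty family and equals `K(X)`. -/
def blacktriangleFun (s : SemistarOperation D K) (A : NonzeroSubmodule D[X] (RatFunc K)) :
    Submodule D[X] (RatFunc K) :=
  ⨅ (z : RatFunc K) (hz : IsPolyMultiplier A.1 z),
    z⁻¹ • polySubmodule (s (contentScaled A z hz)).1

/-- The semistar operation `▲^⋆` of `D[X]`, the largest strict extension of `⋆`. -/
def blacktriangle (s : SemistarOperation D K) : SemistarOperation D[X] (RatFunc K) :=
  ofLE s.blacktriangleFun
    (fun A => le_iInf₂ fun z hz => by
      rw [le_smul_iff_inv_smul_le (inv_ne_zero hz.1), inv_inv]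
      exact (le_polySubmodule_contentSubmodule (isPolyMultiplier_iff.mp hz).2).trans
        (polySubmodule_mono (s.le' (contentScaled A z hz))))
    (fun A B h => le_iInf₂ fun z hz => by
      have hz' : IsPolyMultiplier A.1 z := isPolyMultiplier_iff.mpr
        ⟨hz.1, (smul_submodule_mono z h).trans (isPolyMultiplier_iff.mp hz).2⟩
      refine (iInf₂_le z hz').trans ?_
      exact smul_submodule_mono _ (polySubmodule_mono (s.mono' _ _
        (contentSubmodule_mono (smul_submodule_mono z h)))))
    (fun x hx A => by
      rw [le_smul_iff_inv_smul_le hx]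
      refine le_iInf₂ fun z hz => ?_
      have e : (z * x⁻¹) • (A.scale x hx).1 = z • A.1 := by
        change (z * x⁻¹) • x • A.1 = z • A.1
        rw [smul_smul, inv_mul_cancel_right₀ hx]
      have hz' : IsPolyMultiplier (A.scale x hx).1 (z * x⁻¹) := isPolyMultiplier_iff.mpr
        ⟨mul_ne_zero hz.1 (inv_ne_zero hx), e ▸ (isPolyMultiplier_iff.mp hz).2⟩
      have e2 : contentScaled (A.scale x hx) (z * x⁻¹) hz' = contentScaled A z hz :=
        Subtype.ext (congrArg contentSubmodule e)
      rw [← le_smul_iff_inv_smul_le hx]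
      refine (iInf₂_le (z * x⁻¹) hz').trans ?_
      rw [e2, smul_smul, mul_inv, inv_inv, mul_comm])
    (fun A => le_iInf₂ fun z hz => by
      have h1 : z • s.blacktriangleFun A ≤ polySubmodule (s (contentScaled A z hz)).1 := by
        have h := (le_smul_iff_inv_smul_le (inv_ne_zero hz.1)).mp
          (show s.blacktriangleFun A ≤ _ from iInf₂_le z hz)
        rwa [inv_inv] at h
      have hz' : IsPolyMultiplier (s.blacktriangleFun A) z := isPolyMultiplier_iff.mpr
        ⟨hz.1, h1.trans (polySubmodule_mono le_top)⟩
      refine (iInf₂_le z hz').trans (smul_submodule_mono _ (polySubmodule_mono ?_))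
      refine (s.mono' _ (s (contentScaled A z hz)) ?_).trans (s.idem' _).le
      exact (contentSubmodule_mono h1).trans (contentSubmodule_polySubmodule_le _))

end SemistarOperation

end Poly

section PolyDomain

variable {D K : Type*} [CommRing D] [IsDomain D] [Field K] [Algebra D K] [IsFractionRing D K]

/-- The field `K(X)` is the quotient field of `D[X]`. -/
instance isFractionRing_polynomial_ratFunc : IsFractionRing D[X] (RatFunc K) := by
  have : FaithfulSMul D K := inferInstance
  have : FaithfulSMul D[X] (RatFunc K) := FaithfulSMul.trans D[X] K[X] (RatFunc K)
  have key : ∀ p : K[X], ∃ (b : D) (p' : D[X]), b ≠ 0 ∧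
      algebraMap D[X] (RatFunc K) p' = algebraMap D[X] (RatFunc K) (C b) *
        algebraMap K[X] (RatFunc K) p := by
    intro p
    obtain ⟨b, hb0, hb⟩ := IsLocalization.integerNormalization_spec (nonZeroDivisors D) p
    refine ⟨b, IsLocalization.integerNormalization (nonZeroDivisors D) p,
      nonZeroDivisors.ne_zero hb0, ?_⟩
    rw [IsScalarTower.algebraMap_apply D[X] K[X] (RatFunc K), Polynomial.algebraMap_def,
      coe_mapRingHom, hb, IsScalarTower.algebraMap_apply D[X] K[X] (RatFunc K),
      Polynomial.algebraMap_def, coe_mapRingHom, map_C, ← map_mul, ← algebraMap_smul K b p,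
      smul_eq_C_mul]
  have hC : ∀ b : D, b ≠ 0 → algebraMap D[X] (RatFunc K) (C b) ≠ 0 := by
    intro b hb h
    rw [FaithfulSMul.algebraMap_eq_zero_iff] at h
    exact hb (by simpa using h)
  refine IsFractionRing.of_field D[X] (RatFunc K) fun z => ?_
  obtain ⟨p, q, _, rfl⟩ := IsFractionRing.div_surjective K[X] z
  obtain ⟨b, p', hb, hp⟩ := key p
  obtain ⟨c, q', hc, hq⟩ := key q
  refine ⟨C c * p', C b * q', ?_⟩
  rw [map_mul, map_mul, hp, hq]
  have hb' := hC b hb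
  have hc' := hC c hc
  rw [mul_left_comm, mul_div_mul_left _ _ hb', mul_div_mul_left _ _ hc']

namespace SemistarOperation

/-- The semistar operation `⟨⋆̃⟩` of `D[X]`, which sends `A` to the intersection of `A K[X]` and of
all `A D_Q(X)` for `Q ∈ QMax^{⋆_f}(D)`. -/
def nagataExtension (s : SemistarOperation D K) : SemistarOperation D[X] (RatFunc K) :=
  ofOverrings (insert (polyOverring D K)
    ((fun Q => nagataRing (localizationAt K Q)) '' s.finiteType.QMax))

end SemistarOperation

end PolyDomain

end SemistarTheory

/-! Fix `A` and `x`, and let `I` be the ideal of all `t` in `D[X]` with `t • x ∈ A`; it is nonzero.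
All rings involved are localizations of `D[X]`, so membership of `x` in an extension of `A` is a
condition on `I` alone: in `A D[X]_P` it says that `I ⊄ P`, in `A D_Q(X)` that `I ⊄ Q[X]`, in `A
K[X]` that `I` contains a nonzero constant.

The theorem thus becomes a comparison of primes. Write ▲ for `s.blacktriangle`. Three facts suffice:
`Q[X]` is quasi-maximal for ▲_f when `Q` is quasi-maximal for ⋆_f (`polyPrime_mem_qMax`); a nonzero
ideal without nonzero constants lies in a quasi-maximal ideal (`exists_le_qMax_of_forall_C_notMem`);
a proper quasi-ideal containing a nonzero constant lies in such a `Q[X]` (`exists_le_polyPrime`).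

The second fact holds because `I K[X] = f K[X]` with `f` not a unit, and the multiplier `1/f` forces
the closure of `I` into `f K[X]`. The third rests on `one_mem_blacktriangle`: if `J` contains a
nonzero constant and the closure of its coefficient ideal contains 1, then the closure of `J`
contains 1. Its proof is McCoy's argument applied to `(K/W)[X]`, with `W` the closure of the content
of `zJ` (`mem_coeffSubmodule_of_smul_mem`). -/

noncomputable section SemistarProof

namespace SemistarOperation

/-! ### Extension of submodules to localizations, and finite type -/

section General

variable {R K : Type*} [CommRing R] [Field K] [Algebra R K]

/-- Extension of a submodule to a localization inside `K`: membership is detected by denominators. -/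
theorem mem_mul_subalgebra_iff (A : Submodule R K) (S : Subalgebra R K) (W : Submonoid R)
    (h1 : ∀ y ∈ S, ∃ t ∈ W, ∃ r : R, t • y = algebraMap R K r)
    (h2 : ∀ t ∈ W, ∃ y ∈ S, algebraMap R K t * y = 1) (x : K) :
    x ∈ A * Subalgebra.toSubmodule S ↔ ∃ t ∈ W, t • x ∈ A := by
  constructor
  · intro hx
    induction hx using Submodule.mul_induction_on' with
    | mem_mul_mem a ha y hy =>
      obtain ⟨t, ht, r, hr⟩ := h1 y hy
      refine ⟨t, ht, ?_⟩
      rw [← mul_smul_comm, hr, mul_comm, ← Algebra.smul_def]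
      exact A.smul_mem _ ha
    | add x _ y _ hx hy =>
      obtain ⟨t, ht, hx⟩ := hx
      obtain ⟨u, hu, hy⟩ := hy
      refine ⟨t * u, mul_mem ht hu, ?_⟩
      rw [smul_add]
      refine add_mem ?_ ?_
      · rw [mul_comm, mul_smul]
        exact A.smul_mem _ hx
      · rw [mul_smul]
        exact A.smul_mem _ hy
  · rintro ⟨t, ht, hx⟩
    obtain ⟨y, hy, hty⟩ := h2 t ht
    have : x = t • x * y := by
      rw [Algebra.smul_def, mul_right_comm, hty, one_mul]
    rw [this]
    exact Submodule.mul_mem_mul hx hy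

theorem finiteType_apply (s : SemistarOperation R K) (E : NonzeroSubmodule R K) (x : K) :
    x ∈ (s.finiteType E).1 ↔ ∃ F : NonzeroSubmodule R K, (F.1.FG ∧ F ≤ E) ∧ x ∈ (s F).1 :=
  s.mem_finiteTypeFun E x

theorem finiteType_le (s : SemistarOperation R K) (E : NonzeroSubmodule R K) :
    s.finiteType E ≤ s E := by
  intro x hx
  obtain ⟨F, hF, hx⟩ := (s.finiteType_apply E x).mp hx
  exact s.mono' F E hF.2 hx

end General

/-! ### Existence of quasi-maximal ideals for operations of finite type -/

section Domain

variable {R K : Type*} [CommRing R] [IsDomain R] [Field K] [Algebra R K] [IsFractionRing R K]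

theorem mem_mul_localizationAt_iff (A : Submodule R K) (P : PrimeSpectrum R) (x : K) :
    x ∈ A * Subalgebra.toSubmodule (localizationAt K P) ↔ ∃ t ∉ P.asIdeal, t • x ∈ A := by
  have hne : ∀ t ∈ P.asIdeal.primeCompl, algebraMap R K t ≠ 0 := by
    intro t ht h
    rw [FaithfulSMul.algebraMap_eq_zero_iff] at h
    exact ht (h ▸ zero_mem _)
  refine mem_mul_subalgebra_iff A _ P.asIdeal.primeCompl ?_ ?_ x
  · rintro _ ⟨a, t, ht, rfl⟩
    refine ⟨t, ht, a, ?_⟩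
    rw [Algebra.smul_def, mul_left_comm, mul_inv_cancel₀ (hne t ht), mul_one]
  · intro t ht
    exact ⟨(algebraMap R K t)⁻¹, ⟨1, t, ht, by simp⟩, mul_inv_cancel₀ (hne t ht)⟩

theorem idealSubmodule_mono {I J : Ideal R} (hI : I ≠ ⊥) (hJ : J ≠ ⊥) (h : I ≤ J) :
    idealSubmodule K I hI ≤ idealSubmodule K J hJ := by
  intro x hx
  obtain ⟨y, hy, rfl⟩ := (IsLocalization.mem_coeSubmodule K I).mp hx
  exact (IsLocalization.mem_coeSubmodule K J).mpr ⟨y, h hy, rfl⟩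

theorem algebraMap_mem_idealSubmodule {I : Ideal R} (hI : I ≠ ⊥) {y : R} (hy : y ∈ I) :
    algebraMap R K y ∈ (idealSubmodule K I hI).1 :=
  (IsLocalization.mem_coeSubmodule K I).mpr ⟨y, hy, rfl⟩

theorem IsQuasiIdeal.mem {s : SemistarOperation R K} {I : Ideal R} (hI : s.IsQuasiIdeal I) {y : R}
    (hy : algebraMap R K y ∈ (s (idealSubmodule K I hI.1)).1) : y ∈ I := by
  obtain ⟨h0, h⟩ := hI
  rw [← h]
  exact hy

theorem isQuasiIdeal_of_mem {s : SemistarOperation R K} {I : Ideal R} (hI : I ≠ ⊥)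
    (h : ∀ y : R, algebraMap R K y ∈ (s (idealSubmodule K I hI)).1 → y ∈ I) : s.IsQuasiIdeal I :=
  ⟨hI, le_antisymm h fun _ hy => s.le' _ (algebraMap_mem_idealSubmodule hI hy)⟩

theorem IsQuasiIdeal.one_notMem {s : SemistarOperation R K} {I : Ideal R} (hI : s.IsQuasiIdeal I)
    (h : I ≠ ⊤) : (1 : K) ∉ (s (idealSubmodule K I hI.1)).1 := by
  intro h1
  rw [← map_one (algebraMap R K)] at h1
  exact h ((Ideal.eq_top_iff_one I).mpr (hI.mem h1))

/-- Lets the submodules `F` in the definition of ⋆_f be replaced by finitely generated integral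
ideals when the closure of an ideal is computed. -/
theorem exists_fg_le_idealSubmodule {I : Ideal R} (hI : I ≠ ⊥) (F : NonzeroSubmodule R K)
    (hF : F.1.FG) (h : F ≤ idealSubmodule K I hI) :
    ∃ (J : Ideal R) (hJ : J ≠ ⊥), J.FG ∧ J ≤ I ∧ F = idealSubmodule K J hJ := by
  have hinj : Function.Injective (Algebra.linearMap R K) := FaithfulSMul.algebraMap_injective R K
  have hm : (F.1.comap (Algebra.linearMap R K)).map (Algebra.linearMap R K) = F.1 := by
    refine Submodule.map_comap_eq_of_le fun x hx => ?_
    obtain ⟨y, -, rfl⟩ := (IsLocalization.mem_coeSubmodule K I).mp (h hx)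
    exact ⟨y, rfl⟩
  refine ⟨F.1.comap (Algebra.linearMap R K), ?_, ?_, ?_, Subtype.ext hm.symm⟩
  · intro h0
    apply F.2
    rw [← hm, h0, Submodule.map_bot]
  · exact Submodule.fg_of_fg_map_injective _ hinj (hm.symm ▸ hF)
  · intro y hy
    obtain ⟨z, hz, hzy⟩ := (IsLocalization.mem_coeSubmodule K I).mp (h hy)
    exact hinj hzy ▸ hz

/-- An ideal whose closure does not contain `1` is contained in a quasi-maximal ideal, for the
operation of finite type. -/
theorem exists_le_qMax (s : SemistarOperation R K) {I : Ideal R} (hI : I ≠ ⊥)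
    (h1 : (1 : K) ∉ (s.finiteType (idealSubmodule K I hI)).1) :
    ∃ P ∈ s.finiteType.QMax, I ≤ P.asIdeal := by
  -- Zorn's lemma is applied to all ideals whose closure omits 1, not only to quasi-ideals: for
  -- these the union of a chain causes no difficulty.
  let 𝒮 : Set (Ideal R) :=
    {J | ∃ hJ : J ≠ ⊥, (1 : K) ∉ (s.finiteType (idealSubmodule K J hJ)).1}
  obtain ⟨M, hIM, hM⟩ := zorn_le_nonempty₀ 𝒮 (fun c hc hchain J hJ => by
    have hle : ∀ J ∈ c, J ≤ sSup c := fun J hJ => le_sSup hJ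
    have h0 : sSup c ≠ ⊥ := ne_bot_of_le_ne_bot (hc hJ).1 (hle J hJ)
    refine ⟨sSup c, ⟨h0, fun h => ?_⟩, hle⟩
    obtain ⟨F, ⟨hF, hFc⟩, h⟩ := (s.finiteType_apply _ _).mp h
    obtain ⟨G, hG0, hG, hGc, rfl⟩ := exists_fg_le_idealSubmodule h0 F hF hFc
    -- Finite type enters here: 1 already lies in the closure of a finitely generated `G`, and by
    -- compactness `G` lies in one member of the chain.
    have : ∃ J ∈ c, G ≤ J := by
      have hcpt := (CompleteLattice.isCompactElement_iff_le_of_directed_sSup_le _ G).mp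
        ((Submodule.fg_iff_compact G).mp hG)
      exact hcpt c ⟨J, hJ⟩ hchain.directedOn hGc
    obtain ⟨J', hJ', hGJ⟩ := this
    exact (hc hJ').2 ((s.finiteType_apply _ _).mpr
      ⟨_, ⟨hF, idealSubmodule_mono hG0 (hc hJ').1 hGJ⟩, h⟩)) I ⟨hI, h1⟩
  obtain ⟨⟨hM0, hM1⟩, hmax⟩ := hM
  have hMtop : M ≠ ⊤ := by
    rintro rfl
    apply hM1
    rw [← map_one (algebraMap R K)]
    exact s.finiteType.le' _ (algebraMap_mem_idealSubmodule hM0 Submodule.mem_top)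
  have hMq : s.finiteType.IsQuasiIdeal M := by
    refine isQuasiIdeal_of_mem hM0 ?_
    -- By idempotence the closure of `N` still omits 1, so maximality of `M` gives `N ≤ M`.
    let N : Ideal R := (s.finiteType (idealSubmodule K M hM0)).1.comap (Algebra.linearMap R K)
    have hMN : M ≤ N := fun y hy => s.finiteType.le' _ (algebraMap_mem_idealSubmodule hM0 hy)
    have hN0 : N ≠ ⊥ := ne_bot_of_le_ne_bot hM0 hMN
    have hN : N ∈ 𝒮 := by
      refine ⟨hN0, fun h => hM1 ?_⟩
      rw [← s.finiteType.idem']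
      refine s.finiteType.mono' (idealSubmodule K N hN0) _ ?_ h
      intro x hx
      obtain ⟨y, hy, rfl⟩ := (IsLocalization.mem_coeSubmodule K N).mp hx
      exact hy
    exact hmax hN hMN
  have hQ : s.finiteType.IsQuasiMaximal M :=
    ⟨⟨hMtop, hMq⟩, fun J hJ hMJ => hmax ⟨hJ.2.1, hJ.2.one_notMem hJ.1⟩ hMJ⟩
  exact ⟨⟨M, hQ.isPrime⟩, hQ, hIM⟩

end Domain

end SemistarOperation

/-! ### Polynomials with coefficients in a submodule, and McCoy's theorem -/

section Poly

variable {D K : Type*} [CommRing D] [Field K] [Algebra D K]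

theorem algebraMap_mem_polySubmodule {W : Submodule D K} {p : K[X]} :
    algebraMap K[X] (RatFunc K) p ∈ polySubmodule W ↔ ∀ n, p.coeff n ∈ W := by
  constructor
  · rintro ⟨f, hf, hfp⟩
    rwa [← IsFractionRing.injective K[X] (RatFunc K) hfp]
  · exact fun h => ⟨p, h, rfl⟩

theorem smul_eq_map_mul (g : D[X]) (p : K[X]) : g • p = g.map (algebraMap D K) * p := by
  rw [Algebra.smul_def, Polynomial.algebraMap_def, coe_mapRingHom]

theorem coeff_C_smul (c : D) (p : K[X]) (n : ℕ) : (C c • p).coeff n = c • p.coeff n := by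
  rw [smul_eq_map_mul, map_C, coeff_C_mul, ← Algebra.smul_def]

/-- The polynomials with coefficients in `W`, as a submodule of `K[X]`. -/
def coeffSubmodule (W : Submodule D K) : Submodule D[X] K[X] :=
  (polySubmodule W).comap (IsScalarTower.toAlgHom D[X] K[X] (RatFunc K)).toLinearMap

theorem mem_coeffSubmodule {W : Submodule D K} {p : K[X]} :
    p ∈ coeffSubmodule W ↔ ∀ n, p.coeff n ∈ W :=
  algebraMap_mem_polySubmodule

/-- A form of McCoy's theorem: if `K / W` has no nonzero element that is annihilated by all
coefficients of all polynomials in `J`, then `(K / W)[X]` has no nonzero element annihilated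
by `J`. -/
theorem mem_coeffSubmodule_of_smul_mem (W : Submodule D K) (J : Set D[X])
    (hW : ∀ y : K, (∀ g ∈ J, ∀ i, g.coeff i • y ∈ W) → y ∈ W) (n : ℕ) :
    ∀ z : K[X], z.degree < n → (∀ g ∈ J, g • z ∈ coeffSubmodule W) → z ∈ coeffSubmodule W := by
  induction n with
  | zero =>
    intro z hz _
    have : z = 0 := by
      ext k
      rw [degree_lt_iff_coeff_zero] at hz
      simpa using hz k (Nat.zero_le k)
    exact this ▸ zero_mem _
  | succ n ih =>
    intro z hz hJ
    rw [degree_lt_iff_coeff_zero] at hz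
    -- Descending induction on `i`, with `m` as the counter: above the degree of `g` the coefficient
    -- vanishes.
    have key : ∀ g ∈ J, ∀ m i, g.natDegree < i + m → C (g.coeff i) • z ∈ coeffSubmodule W := by
      intro g hg m
      induction m with
      | zero =>
        intro i hi
        rw [coeff_eq_zero_of_natDegree_lt (show g.natDegree < i from hi), C_0, zero_smul]
        exact zero_mem _
      | succ m ihm =>
        intro i hi
        have htop : g.coeff i • z.coeff n ∈ W := by
          -- In the coefficient of `g • z` at `i + n`, terms with `a < i` vanish by the degree bound
          -- on `z`, and those with `a > i` lie in `W` by the descending induction. Only the term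
          -- `(i, n)` remains.
          have h := mem_coeffSubmodule.mp (hJ g hg) (i + n)
          rw [smul_eq_map_mul, coeff_mul, ← Finset.add_sum_erase _ _
            (Finset.HasAntidiagonal.mem_antidiagonal.mpr rfl : (i, n) ∈ Finset.HasAntidiagonal.antidiagonal (i + n))] at h
          simp only [coeff_map, ← Algebra.smul_def] at h
          refine (Submodule.add_mem_iff_left _ (sum_mem ?_)).mp h
          rintro ⟨a, b⟩ hab
          rw [Finset.mem_erase, Finset.HasAntidiagonal.mem_antidiagonal] at hab
          obtain ⟨hne, hab⟩ := hab
          dsimp only at hab ⊢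
          rcases lt_trichotomy a i with ha | rfl | ha
          · rw [hz b (by omega), smul_zero]
            exact zero_mem _
          · exact absurd (by rw [Nat.add_left_cancel hab]) hne
          · rw [← coeff_C_smul]
            exact mem_coeffSubmodule.mp (ihm a (by omega)) b
        have hmon : monomial n (g.coeff i • z.coeff n) ∈ coeffSubmodule W := by
          refine mem_coeffSubmodule.mpr fun k => ?_
          rw [coeff_monomial]
          split_ifs
          · exact htop
          · exact zero_mem _
        -- Removing the top term, now known to lie in `W[X]`, lowers the degree bound, so the outer
        -- induction applies.
        have hz' : C (g.coeff i) • z - monomial n (g.coeff i • z.coeff n) ∈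
            coeffSubmodule W := by
          refine ih _ ?_ fun h hh => ?_
          · rw [degree_lt_iff_coeff_zero]
            intro k hk
            rw [coeff_sub, coeff_C_smul, coeff_monomial]
            split_ifs with hnk
            · rw [hnk, sub_self]
            · rw [hz k (by omega), smul_zero, sub_zero]
          · rw [smul_sub, smul_comm]
            exact sub_mem (Submodule.smul_mem _ _ (hJ h hh)) (Submodule.smul_mem _ _ hmon)
        simpa using add_mem hz' hmon
    refine mem_coeffSubmodule.mpr fun k => hW _ fun g hg i => ?_
    rw [← coeff_C_smul]
    exact mem_coeffSubmodule.mp (key g hg (g.natDegree + 1) i (by omega)) k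

end Poly

/-! ### `K[X]` and the Nagata rings as localizations of `D[X]` -/

section PolyDomain

variable {D K : Type*} [CommRing D] [IsDomain D] [Field K] [Algebra D K] [IsFractionRing D K]

theorem algebraMap_ratFunc_eq (p : D[X]) :
    algebraMap D[X] (RatFunc K) p = algebraMap K[X] (RatFunc K) (p.map (algebraMap D K)) := by
  rw [IsScalarTower.algebraMap_apply D[X] K[X] (RatFunc K), Polynomial.algebraMap_def,
    coe_mapRingHom]

theorem algebraMap_ratFunc_ne_zero {p : D[X]} (hp : p ≠ 0) : algebraMap D[X] (RatFunc K) p ≠ 0 := by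
  rwa [Ne, FaithfulSMul.algebraMap_eq_zero_iff]

/-- `K[X]` is the localization of `D[X]` at the nonzero constants. -/
theorem mem_mul_polyOverring_iff (A : Submodule D[X] (RatFunc K)) (x : RatFunc K) :
    x ∈ A * Subalgebra.toSubmodule (polyOverring D K) ↔ ∃ d : D, d ≠ 0 ∧ (C d : D[X]) • x ∈ A := by
  have h := SemistarOperation.mem_mul_subalgebra_iff A (polyOverring D K)
    ((nonZeroDivisors D).map (C : D →+* D[X])) ?_ ?_ x
  · rw [h]
    constructor
    · rintro ⟨_, ⟨d, hd, rfl⟩, hx⟩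
      exact ⟨d, nonZeroDivisors.ne_zero hd, hx⟩
    · rintro ⟨d, hd, hx⟩
      exact ⟨C d, ⟨d, mem_nonZeroDivisors_of_ne_zero hd, rfl⟩, hx⟩
  · rintro _ ⟨p, rfl⟩
    obtain ⟨b, hb0, hb⟩ := IsLocalization.integerNormalization_spec (nonZeroDivisors D) p
    refine ⟨C b, ⟨b, hb0, rfl⟩, IsLocalization.integerNormalization (nonZeroDivisors D) p, ?_⟩
    rw [algebraMap_ratFunc_eq, hb, Algebra.smul_def, algebraMap_ratFunc_eq, map_C,
      ← algebraMap_smul K b p, smul_eq_C_mul, map_mul]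
    rfl
  · rintro _ ⟨d, hd, rfl⟩
    have hd' : algebraMap D K d ≠ 0 := by simpa using nonZeroDivisors.ne_zero hd
    refine ⟨_, ⟨C (algebraMap D K d)⁻¹, rfl⟩, ?_⟩
    change algebraMap D[X] (RatFunc K) (C d) * algebraMap K[X] (RatFunc K) _ = 1
    rw [algebraMap_ratFunc_eq, map_C, ← map_mul, ← C_mul, mul_inv_cancel₀ hd', C_1, map_one]

/-- The prime ideal `Q[X]`. -/
def polyPrime (Q : PrimeSpectrum D) : PrimeSpectrum D[X] :=
  ⟨Q.asIdeal.map C, have := Q.isPrime; Ideal.isPrime_map_C_of_isPrime⟩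

theorem mem_polyPrime {Q : PrimeSpectrum D} {f : D[X]} :
    f ∈ (polyPrime Q).asIdeal ↔ ∀ n, f.coeff n ∈ Q.asIdeal :=
  Ideal.mem_map_C_iff

theorem C_mem_polyPrime {Q : PrimeSpectrum D} {d : D} :
    C d ∈ (polyPrime Q).asIdeal ↔ d ∈ Q.asIdeal := by
  refine ⟨fun h => ?_, fun h => Ideal.mem_map_of_mem _ h⟩
  simpa using mem_polyPrime.mp h 0

/-- The elements outside `Q[X]` are those with unit content over `D_Q`. -/
theorem contentIdeal_map_eq_top_iff (Q : PrimeSpectrum D) (t : D[X]) :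
    (t.map (algebraMap D (SemistarOperation.localizationAt K Q))).contentIdeal = ⊤ ↔
      t ∉ (polyPrime Q).asIdeal := by
  have : IsLocalization Q.asIdeal.primeCompl (SemistarOperation.localizationAt K Q) :=
    Localization.subalgebra.isLocalization_ofField K _ _
  rw [contentIdeal_map_eq_map_contentIdeal, ← not_iff_comm.mp
    (IsLocalization.map_algebraMap_ne_top_iff_disjoint Q.asIdeal.primeCompl
      (SemistarOperation.localizationAt K Q) t.contentIdeal), mem_polyPrime]
  rw [not_iff_not, Set.disjoint_left]
  constructor
  · intro h n
    by_contra hn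
    exact h hn (t.coeff_mem_contentIdeal n)
  · intro h a ha hat
    apply ha
    refine (Ideal.span_le.mpr ?_ : t.contentIdeal ≤ Q.asIdeal) hat
    intro c hc
    obtain ⟨n, -, rfl⟩ := mem_coeffs_iff.mp hc
    exact h n

/-- `D_Q(X)` is the localization of `D[X]` at the prime `Q[X]`. -/
theorem mem_mul_nagataRing_iff (A : Submodule D[X] (RatFunc K)) (Q : PrimeSpectrum D)
    (x : RatFunc K) :
    x ∈ A * Subalgebra.toSubmodule (nagataRing (SemistarOperation.localizationAt K Q)) ↔
      ∃ t ∉ (polyPrime Q).asIdeal, t • x ∈ A := by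
  have : IsLocalization Q.asIdeal.primeCompl (SemistarOperation.localizationAt K Q) :=
    Localization.subalgebra.isLocalization_ofField K _ _
  set T := SemistarOperation.localizationAt K Q with hT
  have hmap : ∀ p : D[X], algebraMap D[X] (RatFunc K) p = algebraMap K[X] (RatFunc K)
      ((p.map (algebraMap D T)).map (algebraMap T K)) := by
    intro p
    rw [Polynomial.map_map, ← IsScalarTower.algebraMap_eq, algebraMap_ratFunc_eq]
  refine SemistarOperation.mem_mul_subalgebra_iff A _ (polyPrime Q).asIdeal.primeCompl ?_ ?_ x
  · rintro _ ⟨f, g, hg, rfl⟩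
    obtain ⟨b, hb, hf⟩ := IsLocalization.integerNormalization_spec Q.asIdeal.primeCompl f
    obtain ⟨c, hc, hg'⟩ := IsLocalization.integerNormalization_spec Q.asIdeal.primeCompl g
    set f' := IsLocalization.integerNormalization Q.asIdeal.primeCompl f
    set g' := IsLocalization.integerNormalization Q.asIdeal.primeCompl g
    rw [← algebraMap_smul T b f, smul_eq_C_mul] at hf
    rw [← algebraMap_smul T c g, smul_eq_C_mul] at hg'
    have hunit : ∀ b ∈ Q.asIdeal.primeCompl, (C (algebraMap D T b)).contentIdeal = ⊤ := by
      intro b hb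
      rw [contentIdeal_C, Ideal.span_singleton_eq_top]
      exact IsLocalization.map_units T ⟨b, hb⟩
    have htop : ((C b * g').map (algebraMap D T)).contentIdeal = ⊤ := by
      rw [Polynomial.map_mul, map_C, hg']
      exact contentIdeal_mul_eq_top_of_contentIdeal_eq_top (hunit b hb)
        (contentIdeal_mul_eq_top_of_contentIdeal_eq_top (hunit c hc) hg)
    have hg0 : algebraMap K[X] (RatFunc K) (g.map (algebraMap T K)) ≠ 0 := by
      intro h0
      rw [FaithfulSMul.algebraMap_eq_zero_iff, Polynomial.map_eq_zero_iff Subtype.val_injective]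
        at h0
      rw [h0, contentIdeal_zero] at hg
      exact bot_ne_top hg
    -- With `f' = b f` and `g' = c g`, both `b g' · (f/g)` and `c f'` equal `b c f`.
    refine ⟨C b * g', (contentIdeal_map_eq_top_iff Q _).mp htop, C c * f', ?_⟩
    rw [Algebra.smul_def, hmap, hmap, Polynomial.map_mul (algebraMap D T),
      Polynomial.map_mul (algebraMap D T), hf, hg', map_C, map_C]
    simp only [Polynomial.map_mul, map_mul]
    field_simp
  · intro t ht
    have htop := (contentIdeal_map_eq_top_iff (K := K) Q t).mpr ht
    refine ⟨_, ⟨1, t.map (algebraMap D T), htop, rfl⟩, ?_⟩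
    rw [← hmap, Polynomial.map_one, map_one]
    exact mul_one_div_cancel (algebraMap_ratFunc_ne_zero fun h => ht (h ▸ zero_mem _))

/-! ### Coefficient ideals and finite generation -/

/-- The ideal of `D` generated by the coefficients of all polynomials in `J`. -/
def coeffIdeal (J : Ideal D[X]) : Ideal D :=
  Ideal.span {c | ∃ g ∈ J, ∃ n, g.coeff n = c}

theorem coeff_mem_coeffIdeal {J : Ideal D[X]} {g : D[X]} (hg : g ∈ J) (n : ℕ) :
    g.coeff n ∈ coeffIdeal J :=
  Ideal.subset_span ⟨g, hg, n, rfl⟩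

theorem coeffIdeal_le {J : Ideal D[X]} {I : Ideal D} (h : ∀ g ∈ J, ∀ n, g.coeff n ∈ I) :
    coeffIdeal J ≤ I := by
  refine Ideal.span_le.mpr ?_
  rintro _ ⟨g, hg, n, rfl⟩
  exact h g hg n

theorem coeffIdeal_mono {J J' : Ideal D[X]} (h : J ≤ J') : coeffIdeal J ≤ coeffIdeal J' :=
  coeffIdeal_le fun _ hg n => coeff_mem_coeffIdeal (h hg) n

theorem coeffIdeal_ne_bot {J : Ideal D[X]} (hJ : J ≠ ⊥) : coeffIdeal J ≠ ⊥ := by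
  intro h
  apply hJ
  rw [eq_bot_iff]
  intro g hg
  rw [Ideal.mem_bot]
  ext n
  simpa [h] using coeff_mem_coeffIdeal hg n

/-- Each element of `coeffIdeal M` involves the coefficients of only finitely many polynomials. -/
theorem exists_fg_le_coeffIdeal (M : Ideal D[X]) (I : Ideal D) (hI : I.FG)
    (h : I ≤ coeffIdeal M) : ∃ J : Ideal D[X], J.FG ∧ J ≤ M ∧ I ≤ coeffIdeal J := by
  induction I, hI using Submodule.fg_induction with
  | singleton x =>
    have hx : x ∈ coeffIdeal M := h (Submodule.mem_span_singleton_self x)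
    suffices H : ∃ J : Ideal D[X], J.FG ∧ J ≤ M ∧ x ∈ coeffIdeal J by
      obtain ⟨J, h1, h2, h3⟩ := H
      exact ⟨J, h1, h2, (Submodule.span_singleton_le_iff_mem _ _).mpr h3⟩
    clear h
    refine Submodule.span_induction ?_ ?_ ?_ ?_ hx
    · rintro _ ⟨g, hg, n, rfl⟩
      exact ⟨Ideal.span {g}, Submodule.fg_span_singleton g,
        (Ideal.span_singleton_le_iff_mem M).mpr hg,
        coeff_mem_coeffIdeal (Ideal.mem_span_singleton_self g) n⟩
    · exact ⟨⊥, Submodule.fg_bot, bot_le, zero_mem _⟩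
    · rintro x y - - ⟨J, h1, h2, h3⟩ ⟨J', h1', h2', h3'⟩
      exact ⟨J ⊔ J', Submodule.FG.sup h1 h1', sup_le h2 h2', add_mem (coeffIdeal_mono le_sup_left h3)
        (coeffIdeal_mono le_sup_right h3')⟩
    · rintro a x - ⟨J, h1, h2, h3⟩
      exact ⟨J, h1, h2, Submodule.smul_mem _ _ h3⟩
  | sup I₁ I₂ _ _ ih₁ ih₂ =>
    obtain ⟨J, h1, h2, h3⟩ := ih₁ (le_sup_left.trans h)
    obtain ⟨J', h1', h2', h3'⟩ := ih₂ (le_sup_right.trans h)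
    exact ⟨J ⊔ J', Submodule.FG.sup h1 h1', sup_le h2 h2', sup_le (h3.trans (coeffIdeal_mono le_sup_left))
      (h3'.trans (coeffIdeal_mono le_sup_right))⟩

theorem exists_fg_le_map_C (Q : Ideal D) (J : Ideal D[X]) (hJ : J.FG) (h : J ≤ Q.map C) :
    ∃ I : Ideal D, I.FG ∧ I ≤ Q ∧ J ≤ I.map C := by
  induction J, hJ using Submodule.fg_induction with
  | singleton g =>
    refine ⟨g.contentIdeal, g.contentIdeal_FG, Ideal.span_le.mpr ?_,
      (Submodule.span_singleton_le_iff_mem _ _).mpr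
        (Ideal.mem_map_C_iff.mpr g.coeff_mem_contentIdeal)⟩
    intro c hc
    obtain ⟨n, -, rfl⟩ := mem_coeffs_iff.mp hc
    exact Ideal.mem_map_C_iff.mp (h (Submodule.mem_span_singleton_self g)) n
  | sup J₁ J₂ _ _ ih₁ ih₂ =>
    obtain ⟨I, h1, h2, h3⟩ := ih₁ (le_sup_left.trans h)
    obtain ⟨I', h1', h2', h3'⟩ := ih₂ (le_sup_right.trans h)
    exact ⟨I ⊔ I', Submodule.FG.sup h1 h1', sup_le h2 h2', sup_le (h3.trans (Ideal.map_mono le_sup_left))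
      (h3'.trans (Ideal.map_mono le_sup_right))⟩

/-! ### Quasi-maximal ideals of `D[X]` -/

namespace SemistarOperation

/-- `A^▲ ⊆ z⁻¹ K[X]` for each nonzero `z` in `(K[X] : A)`. -/
theorem smul_mem_of_mem_blacktriangle (s : SemistarOperation D K)
    {A : NonzeroSubmodule D[X] (RatFunc K)} {x : RatFunc K} (hx : x ∈ (s.blacktriangle A).1)
    (z : RatFunc K) (hz : IsPolyMultiplier A.1 z) :
    z * x ∈ polySubmodule (s (contentScaled A z hz)).1 := by
  have h : x ∈ z⁻¹ • polySubmodule (s (contentScaled A z hz)).1 :=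
    (show s.blacktriangleFun A ≤ _ from iInf₂_le z hz) hx
  rwa [Submodule.mem_smul_iff_inv_mul_mem (inv_ne_zero hz.1), inv_inv] at h

/-- If the coefficients of `J` generate an ideal with closure containing `1`, and if `J` contains a
nonzero constant, then the closure of `J` contains `1`. -/
theorem one_mem_blacktriangle (s : SemistarOperation D K) {J : Ideal D[X]} (hJ : J ≠ ⊥) {d : D}
    (hd : d ≠ 0) (hdJ : C d ∈ J)
    (h1 : (1 : K) ∈ (s (idealSubmodule K (coeffIdeal J) (coeffIdeal_ne_bot hJ))).1) :
    (1 : RatFunc K) ∈ (s.blacktriangle (idealSubmodule (RatFunc K) J hJ)).1 := by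
  change (1 : RatFunc K) ∈ s.blacktriangleFun _
  rw [blacktriangleFun]
  simp only [Submodule.mem_iInf]
  intro z hz
  rw [Submodule.mem_smul_iff_inv_mul_mem (inv_ne_zero hz.1), inv_inv, mul_one]
  have hzJ := (isPolyMultiplier_iff.mp hz).2
  have hmem : ∀ g ∈ J, g • z ∈ z • (idealSubmodule (RatFunc K) J hJ).1 := by
    intro g hg
    rw [Algebra.smul_def, mul_comm]
    exact Submodule.smul_mem_pointwise_smul _ z _ (algebraMap_mem_idealSubmodule hJ hg)
  have hd' : algebraMap D K d ≠ 0 := by simpa using hd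
  -- The constant in `J` makes `z` a polynomial: `dz ∈ zJ ⊆ K[X]` and `d` is invertible in `K`.
  obtain ⟨p, rfl⟩ : ∃ p : K[X], algebraMap K[X] (RatFunc K) p = z := by
    obtain ⟨f, -, hf⟩ := hzJ (hmem _ hdJ)
    refine ⟨C (algebraMap D K d)⁻¹ * f, ?_⟩
    rw [map_mul, hf, Algebra.smul_def, algebraMap_ratFunc_eq, map_C, ← mul_assoc, ← map_mul,
      ← C_mul, inv_mul_cancel₀ hd', C_1, map_one, one_mul]
  set W := s (contentScaled _ _ hz) with hWdef
  refine algebraMap_mem_polySubmodule.mpr (mem_coeffSubmodule.mp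
    (mem_coeffSubmodule_of_smul_mem W.1 (J : Set D[X]) ?_ (p.natDegree + 1) p ?_ ?_))
  -- If `y` multiplies the coefficient ideal into `W`, it multiplies the closure of that ideal into
  -- `W^⋆ = W`. That closure contains 1, so `y ∈ W`.
  · intro y hy
    by_cases hy0 : y = 0
    · exact hy0 ▸ zero_mem _
    have hle : (idealSubmodule K (coeffIdeal J) (coeffIdeal_ne_bot hJ)).scale y hy0 ≤ W := by
      rintro _ ⟨w, hw, rfl⟩
      obtain ⟨c, hc, rfl⟩ := (IsLocalization.mem_coeSubmodule K _).mp hw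
      have : coeffIdeal J ≤ W.1.comap (LinearMap.toSpanSingleton D K y) :=
        coeffIdeal_le fun g hg n => hy g hg n
      have := this hc
      rw [Submodule.mem_comap, LinearMap.toSpanSingleton_apply, Algebra.smul_def, mul_comm] at this
      exact this
    have h2 := s.mono' _ _ hle
    rw [s.scale', hWdef, s.idem'] at h2
    have h3 := h2 (Submodule.smul_mem_pointwise_smul _ y _ h1)
    rwa [smul_eq_mul, mul_one] at h3
  · exact degree_le_natDegree.trans_lt (by exact_mod_cast Nat.lt_succ_self _)
  · intro g hg
    refine mem_coeffSubmodule.mpr fun n => s.le' (contentScaled _ _ hz) ?_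
    refine Submodule.subset_span ⟨g • p, ?_, n, rfl⟩
    have := hmem g hg
    rwa [Algebra.smul_def, algebraMap_ratFunc_eq, ← map_mul, ← smul_eq_map_mul] at this

/-- A quasi-ideal of `D[X]` that contains a nonzero constant is contained in some `Q[X]`. -/
theorem exists_le_polyPrime (s : SemistarOperation D K) {M : Ideal D[X]}
    (hM : s.blacktriangle.finiteType.IsQuasiIdeal M) (htop : M ≠ ⊤) {d : D} (hd : d ≠ 0)
    (hdM : C d ∈ M) : ∃ Q ∈ s.finiteType.QMax, M ≤ (polyPrime Q).asIdeal := by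
  have hc0 := coeffIdeal_ne_bot hM.1
  obtain ⟨Q, hQ, hle⟩ := s.exists_le_qMax hc0 (fun h1 => by
    obtain ⟨F, ⟨hF, hFc⟩, h1⟩ := (s.finiteType_apply _ _).mp h1
    obtain ⟨I, hI0, hI, hIc, rfl⟩ := exists_fg_le_idealSubmodule hc0 F hF hFc
    have hIfg : I.FG := by
      have hinj : Function.Injective (Algebra.linearMap D K) :=
        FaithfulSMul.algebraMap_injective D K
      exact Submodule.fg_of_fg_map_injective _ hinj hF
    obtain ⟨J, hJ, hJM, hIJ⟩ := exists_fg_le_coeffIdeal M I hIfg hIc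
    -- The constant is adjoined because `one_mem_blacktriangle` requires one inside the finitely
    -- generated ideal itself.
    let J' := J ⊔ Ideal.span {C d}
    have hdJ : C d ∈ J' := le_sup_right (a := J) (Ideal.mem_span_singleton_self (C d))
    have hJ'0 : J' ≠ ⊥ := fun h => by
      rw [h, Ideal.mem_bot, C_eq_zero] at hdJ
      exact hd hdJ
    have hJ'M : J' ≤ M := sup_le hJM ((Ideal.span_singleton_le_iff_mem M).mpr hdM)
    have hJ'fg : J'.FG := Submodule.FG.sup hJ (Submodule.fg_span_singleton (C d))
    refine hM.one_notMem htop ((s.blacktriangle.finiteType_apply _ _).mpr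
      ⟨idealSubmodule (RatFunc K) J' hJ'0, ⟨Submodule.FG.map _ hJ'fg, idealSubmodule_mono _ _ hJ'M⟩,
        s.one_mem_blacktriangle hJ'0 hd hdJ (s.mono' _ _ ?_ h1)⟩)
    exact idealSubmodule_mono _ _ (hIJ.trans (coeffIdeal_mono le_sup_left)))
  exact ⟨Q, hQ, fun g hg => mem_polyPrime.mpr fun n => hle (coeff_mem_coeffIdeal hg n)⟩

/-- The multiplier `z = 1` suffices: it puts the coefficients of `f` in `c(J)^⋆` for some finitely
generated `J ⊆ Q[X]`. Such a `J` lies in `I[X]` with `I ⊆ Q` finitely generated, so these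
coefficients lie in `Q^{⋆_f} ∩ D = Q`. -/
theorem isQuasiIdeal_polyPrime (s : SemistarOperation D K) {Q : PrimeSpectrum D}
    (hQ : s.finiteType.IsQuasiIdeal Q.asIdeal) :
    s.blacktriangle.finiteType.IsQuasiIdeal (polyPrime Q).asIdeal := by
  have h0 : (polyPrime Q).asIdeal ≠ ⊥ := by
    obtain ⟨q, hq, hq0⟩ := Submodule.exists_mem_ne_zero_of_ne_bot hQ.1
    intro h
    have := C_mem_polyPrime.mpr hq
    rw [h, Ideal.mem_bot, C_eq_zero] at this
    exact hq0 this
  refine isQuasiIdeal_of_mem h0 fun f hf => mem_polyPrime.mpr fun n => hQ.mem ?_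
  obtain ⟨F, ⟨hF, hFQ⟩, hf⟩ := (s.blacktriangle.finiteType_apply _ _).mp hf
  obtain ⟨J, hJ0, hJ, hJQ, rfl⟩ := exists_fg_le_idealSubmodule h0 F hF hFQ
  have hz : IsPolyMultiplier (idealSubmodule (RatFunc K) J hJ0).1 1 := by
    refine isPolyMultiplier_iff.mpr ⟨one_ne_zero, ?_⟩
    rw [one_smul]
    intro x hx
    obtain ⟨g, -, rfl⟩ := (IsLocalization.mem_coeSubmodule _ J).mp hx
    rw [algebraMap_ratFunc_eq]
    exact algebraMap_mem_polySubmodule.mpr fun _ => Submodule.mem_top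
  have h := s.smul_mem_of_mem_blacktriangle hf 1 hz
  rw [one_mul, algebraMap_ratFunc_eq, algebraMap_mem_polySubmodule] at h
  have h := h n
  rw [coeff_map] at h
  obtain ⟨I, hI, hIQ, hJI⟩ := exists_fg_le_map_C Q.asIdeal J hJ hJQ
  have hI0 : I ≠ ⊥ := by
    rintro rfl
    rw [Ideal.map_bot] at hJI
    exact hJ0 (le_bot_iff.mp hJI)
  refine (s.finiteType_apply _ _).mpr ⟨idealSubmodule K I hI0,
    ⟨Submodule.FG.map _ hI, idealSubmodule_mono _ _ hIQ⟩, s.mono' _ _ (Submodule.span_le.mpr ?_) h⟩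
  rintro _ ⟨p, hp, n, rfl⟩
  rw [one_smul] at hp
  obtain ⟨g, hg, hgp⟩ := (IsLocalization.mem_coeSubmodule _ J).mp hp
  rw [algebraMap_ratFunc_eq] at hgp
  rw [← IsFractionRing.injective K[X] (RatFunc K) hgp, coeff_map]
  exact algebraMap_mem_idealSubmodule hI0 (Ideal.mem_map_C_iff.mp (hJI hg) n)

/-- The ideals `Q[X]`, for `Q` quasi-maximal, are quasi-maximal. -/
theorem polyPrime_mem_qMax (s : SemistarOperation D K) {Q : PrimeSpectrum D}
    (hQ : Q ∈ s.finiteType.QMax) : polyPrime Q ∈ s.blacktriangle.finiteType.QMax := by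
  refine ⟨⟨(polyPrime Q).isPrime.ne_top, s.isQuasiIdeal_polyPrime hQ.1.2⟩, fun J hJ hQJ => ?_⟩
  -- A nonzero `q ∈ Q` is a constant in `J`, so `J` lies in some `Q'[X]`. Then `Q ⊆ Q'`, and
  -- maximality of `Q` gives `Q' ⊆ Q`.
  obtain ⟨q, hq, hq0⟩ := Submodule.exists_mem_ne_zero_of_ne_bot hQ.1.2.1
  obtain ⟨Q', hQ', hJQ'⟩ := s.exists_le_polyPrime hJ.2 hJ.1 hq0 (hQJ (C_mem_polyPrime.mpr hq))
  have h : Q.asIdeal ≤ Q'.asIdeal := fun a ha =>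
    C_mem_polyPrime.mp (hJQ' (hQJ (C_mem_polyPrime.mpr ha)))
  have h' := hQ.2 hQ'.1 h
  exact hJQ'.trans (Ideal.map_mono h')

/-- A nonzero ideal of `D[X]` without nonzero constants is contained in a quasi-maximal ideal. -/
theorem exists_le_qMax_of_forall_C_notMem (s : SemistarOperation D K) {I : Ideal D[X]} (hI : I ≠ ⊥)
    (h : ∀ d : D, d ≠ 0 → C d ∉ I) : ∃ P ∈ s.blacktriangle.finiteType.QMax, I ≤ P.asIdeal := by
  refine exists_le_qMax _ hI fun h1 => ?_
  have h1 := s.blacktriangle.finiteType_le _ h1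
  obtain ⟨f, hf⟩ := (IsPrincipalIdealRing.principal (I.map (algebraMap D[X] K[X]))).principal
  have hIf : ∀ g ∈ I, f ∣ g.map (algebraMap D K) := by
    intro g hg
    rw [← Ideal.mem_span_singleton, ← Ideal.submodule_span_eq, ← hf]
    exact Ideal.mem_map_of_mem (algebraMap D[X] K[X]) hg
  have hf0 : f ≠ 0 := by
    rintro rfl
    obtain ⟨g, hg, hg0⟩ := Submodule.exists_mem_ne_zero_of_ne_bot hI
    have := zero_dvd_iff.mp (hIf g hg)
    rw [Polynomial.map_eq_zero_iff (FaithfulSMul.algebraMap_injective D K)] at this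
    exact hg0 this
  have hfz : algebraMap K[X] (RatFunc K) f ≠ 0 := by
    rwa [Ne, FaithfulSMul.algebraMap_eq_zero_iff]
  have hz : IsPolyMultiplier (idealSubmodule (RatFunc K) I hI).1
      (algebraMap K[X] (RatFunc K) f)⁻¹ := by
    refine isPolyMultiplier_iff.mpr ⟨inv_ne_zero hfz, ?_⟩
    rintro _ ⟨x, hx, rfl⟩
    obtain ⟨g, hg, rfl⟩ := (IsLocalization.mem_coeSubmodule _ I).mp hx
    obtain ⟨p, hp⟩ := hIf g hg
    refine ⟨p, fun _ => Submodule.mem_top, ?_⟩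
    change _ = (algebraMap K[X] (RatFunc K) f)⁻¹ * algebraMap D[X] (RatFunc K) g
    rw [algebraMap_ratFunc_eq, hp, map_mul, inv_mul_cancel_left₀ hfz]
  obtain ⟨p, -, hp⟩ := s.smul_mem_of_mem_blacktriangle h1 _ hz
  -- The multiplier `1/f` sends 1 into `K[X]`, so `f` is a unit and `I K[X] = K[X]`. Clearing
  -- denominators then yields a nonzero constant in `I`, contrary to `h`.
  have hpf : p * f = 1 := by
    apply IsFractionRing.injective K[X] (RatFunc K)
    rw [map_mul, hp, mul_one, inv_mul_cancel₀ hfz, map_one]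
  have hmem : (1 : K[X]) ∈ I.map (algebraMap D[X] K[X]) := by
    rw [hf, Ideal.submodule_span_eq, Ideal.mem_span_singleton]
    exact ⟨p, by rw [mul_comm, hpf]⟩
  have : IsLocalization ((nonZeroDivisors D).map (C : D →+* D[X])) K[X] :=
    Polynomial.isLocalization _ _
  rw [IsLocalization.mem_map_algebraMap_iff ((nonZeroDivisors D).map (C : D →+* D[X]))] at hmem
  obtain ⟨⟨⟨g, hg⟩, ⟨_, d, hd, rfl⟩⟩, hgd⟩ := hmem
  rw [one_mul] at hgd
  have : C d = g := FaithfulSMul.algebraMap_injective D[X] K[X] hgd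
  exact h d (nonZeroDivisors.ne_zero hd) (this ▸ hg)

theorem mem_stableFiniteType_blacktriangle_iff (s : SemistarOperation D K)
    (A : NonzeroSubmodule D[X] (RatFunc K)) (x : RatFunc K) :
    x ∈ (s.blacktriangle.stableFiniteType A).1 ↔
      (∀ Q ∈ s.finiteType.QMax, x ∈ A.1 *
        Subalgebra.toSubmodule (nagataRing (localizationAt K Q))) ∧
      x ∈ A.1 * Subalgebra.toSubmodule (polyOverring D K) := by
  let I : Ideal D[X] := A.1.comap (LinearMap.toSpanSingleton D[X] (RatFunc K) x)
  have hmem : ∀ t : D[X], t ∈ I ↔ t • x ∈ A.1 := fun t => Iff.rfl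
  have hI : I ≠ ⊥ := by
    obtain ⟨a, ha, ha0⟩ := Submodule.exists_mem_ne_zero_of_ne_bot A.2
    -- Writing `x / a = p / q` gives `q • x = p • a ∈ A`, so `q` is a nonzero element of `I`.
    obtain ⟨p, q, hq, hpq⟩ := IsFractionRing.div_surjective D[X] (x / a)
    have hq0 := algebraMap_ratFunc_ne_zero (K := K) (nonZeroDivisors.ne_zero hq)
    intro h
    have : q ∈ I := by
      rw [hmem]
      have : q • x = p • a := by
        rw [Algebra.smul_def, Algebra.smul_def]
        rw [div_eq_div_iff hq0 ha0] at hpq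
        rw [hpq, mul_comm]
      exact this ▸ A.1.smul_mem p ha
    rw [h, Ideal.mem_bot] at this
    exact nonZeroDivisors.ne_zero hq this
  have hL : x ∈ (s.blacktriangle.stableFiniteType A).1 ↔
      ∀ P ∈ s.blacktriangle.finiteType.QMax, ¬ I ≤ P.asIdeal := by
    change x ∈ ⨅ T ∈ localizationAt (RatFunc K) '' s.blacktriangle.finiteType.QMax,
      A.1 * Subalgebra.toSubmodule T ↔ _
    simp only [Submodule.mem_iInf, Set.forall_mem_image, mem_mul_localizationAt_iff, ← hmem,
      SetLike.not_le_iff_exists, and_comm]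
  simp only [hL, mem_mul_nagataRing_iff, mem_mul_polyOverring_iff, ← hmem]
  constructor
  · intro h
    constructor
    · intro Q hQ
      obtain ⟨t, ht, htQ⟩ := SetLike.not_le_iff_exists.mp (h _ (s.polyPrime_mem_qMax hQ))
      exact ⟨t, htQ, ht⟩
    · by_contra! hcon
      obtain ⟨P, hP, hIP⟩ := s.exists_le_qMax_of_forall_C_notMem hI hcon
      exact h P hP hIP
  -- A quasi-maximal `P` containing `I` would contain the constant `d`, hence lie in some `Q[X]`,
  -- which contradicts `I ⊄ Q[X]`.
  · rintro ⟨h, d, hd, hdI⟩ P hP hIP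
    obtain ⟨Q, hQ, hPQ⟩ := s.exists_le_polyPrime hP.1.2 hP.1.1 hd (hIP hdI)
    obtain ⟨t, htQ, ht⟩ := h Q hQ
    exact htQ (hPQ (hIP ht))

end SemistarOperation

end PolyDomain

end SemistarProof

theorem mainTheorem3 {D K : Type*} [CommRing D] [IsDomain D] [Field K] [Algebra D K]
    [IsFractionRing D K] (s : SemistarOperation D K) :
    s.blacktriangle.stableFiniteType = s.nagataExtension ∧
      ∀ A : NonzeroSubmodule D[X] (RatFunc K),
        (s.blacktriangle.stableFiniteType A).1 =
          (⨅ Q ∈ s.finiteType.QMax,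
            A.1 * Subalgebra.toSubmodule (nagataRing (SemistarOperation.localizationAt K Q))) ⊓
            A.1 * Subalgebra.toSubmodule (polyOverring D K) := by
  have h : ∀ A : NonzeroSubmodule D[X] (RatFunc K),
      (s.blacktriangle.stableFiniteType A).1 =
        (⨅ Q ∈ s.finiteType.QMax,
          A.1 * Subalgebra.toSubmodule (nagataRing (SemistarOperation.localizationAt K Q))) ⊓
          A.1 * Subalgebra.toSubmodule (polyOverring D K) := by
    intro A
    ext x
    rw [s.mem_stableFiniteType_blacktriangle_iff]
    simp only [Submodule.mem_inf, Submodule.mem_iInf]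
  refine ⟨SemistarOperation.ext (funext fun A => Subtype.ext ?_), h⟩
  rw [h A]
  change _ = ⨅ T ∈ insert (polyOverring D K)
    ((fun Q => nagataRing (SemistarOperation.localizationAt K Q)) '' s.finiteType.QMax),
    A.1 * Subalgebra.toSubmodule T
  rw [iInf_insert, iInf_image, inf_comm]
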